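/- Let $\Omega$ be one of the following path spaces, with its Borel $\sigma$-algebra: * $\Omega=\mathbb X^{N+1}$, where $\mathbb X$ is a Polish space and $N\in\mathbb N$ (put $T=N$); * $\Omega=C[0,1]$, the continuous functions $[0,1]\to\mathbb X$ with the uniform metric, where $\mathbb X\subset\mathbb R^d$ is closed and connected (put $T=1$); * $\Omega=D[0,1]$, the right-continuous functions $[0,1]\to\mathbb X$ with left limits, with the Skorokhod metric, where $\mathbb X\subset\mathbb R^d$ is closed and connected (put $T=1$). Let $X$ be the canonical process on $\Omega$, $\mathfrak P(E)$ the set of Borel probability measures on $E$ (with the weak topology), and $\mathbb E^P[Y]:=\mathbb E^P[Y^+]-\mathbb E^P[Y^-]$ with the convention $\infty-\infty=-\infty$. Let $G,H:\mathbb X\to(0,\infty)$ be continuous and bounded away from $0$, and put $J(x_0,x_1):=G(x_0)+H(x_1)$. For a continuous $L\ge c>0$ on a space $E$ let $\mathfrak P_L:=\{\mu\in\mathfrak P(E):\int L\,d\mu<\infty\}$ and let $\mathfrak C_L$ be the set of continuous $f:E\to\mathbb R$ with $\sup_{E}|f|/L<\infty$. A set $\Lambda\subset\mathfrak P(E)$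 is called $L$-closed if, whenever $P_n\in\Lambda\cap\mathfrak P_L$ and $P\in\mathfrak P_L$ satisfy $\mathbb E^{P_n}[l]\to\mathbb E^P[l]$ for all $l\in\mathfrak C_L$, one has $P\in\Lambda$. For every $x\in\mathbb X$ let $\Gamma(x)$ be a nonempty set of Borel probability measures on $\Omega$ that are concentrated on $\{\omega:\omega_0=x\}$, and assume that the graph $\{(x,Q):x\in\mathbb X,\ Q\in\Gamma(x)\}$ is an analytic subset of $\mathbb X\times\mathfrak P(\Omega)$. Let $\alpha\in\mathfrak P_G$ and $\beta\in\mathfrak P_H$ be probability measures on $\mathbb X$, and put $$A:=\{P\in\mathfrak P(\Omega):P\circ X_0^{-1}=\alpha\},\qquad B:=\{P\in\mathfrak P(\Omega):P\circ X_T^{-1}=\beta\},$$ $$C:=\{P\in\mathfrak P(\Omega):\ P|_{X_0=x}\in\Gamma(x)\ \text{for } P\circ X_0^{-1}\text{-a.e. }x\},$$ where $P|_{X_0=x}$ is the regular conditional law of $X$ under $P$ given $X_0=x$. Assume that $$(A\cap C)_{0,T}:=\{P\circ(X_0,X_T)^{-1}:\ P\in A\cap C\}$$ is convex and $J$-closed.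 Then $$A\cap B\cap C\neq\emptyset\quad\Longleftrightarrow\quad \alpha(f^\Gamma)\le\beta(f)\ \text{ for all } f\in\mathfrak C_H,$$ where $\beta(f)=\int f\,d\beta$, $\alpha(f^\Gamma)=\mathbb E^{\alpha}[f^\Gamma]$ and $f^\Gamma(x):=\inf_{Q\in\Gamma(x)}\mathbb E^Q[f(X_T)]\in[-\infty,\infty]$. -/

import Mathlib

open MeasureTheory ProbabilityTheory Filter Topology
open scoped NNReal ENNReal unitInterval

noncomputable section

namespace ConstrainedTransport

/-! ### Weights, weighted classes of measures and of functions -/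

section Weights

variable {E : Type*} [TopologicalSpace E] [MeasurableSpace E]

/-- A weight: a continuous positive function that is bounded away from `0`. -/
def IsWeight (F : E → ℝ) : Prop :=
  Continuous F ∧ ∃ c : ℝ, 0 < c ∧ ∀ x, c ≤ F x

/-- The probability measures `μ` with `μ(F) < ∞`. -/
def weightedLaws (F : E → ℝ) : Set (ProbabilityMeasure E) :=
  {μ | Integrable F (μ : Measure E)}

/-- The continuous functions `f` with `sup |f| / F < ∞`. -/
def weightedFunctions (F : E → ℝ) : Set (E → ℝ) :=
  {f | Continuous f ∧ BddAbove (Set.range fun x => |f x| / F x)}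

/-- `L`-closedness of a set `Λ` of probability measures: whenever `Pₙ ∈ Λ` and `P` have finite
`L`-moment and `Pₙ(l) → P(l)` for every continuous `l` with `sup |l| / L < ∞`, then `P ∈ Λ`. -/
def IsWeightClosed (L : E → ℝ) (Λ : Set (ProbabilityMeasure E)) : Prop :=
  ∀ (Pn : ℕ → ProbabilityMeasure E) (P : ProbabilityMeasure E),
    (∀ n, Pn n ∈ Λ) → (∀ n, Pn n ∈ weightedLaws L) → P ∈ weightedLaws L →
    (∀ l ∈ weightedFunctions L,
      Tendsto (fun n => ∫ x, l x ∂(Pn n : Measure E)) atTop (𝓝 (∫ x, l x ∂(P : Measure E)))) →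
    P ∈ Λ

/-- Convexity of a set of probability measures, inside the cone of measures. -/
def IsConvexLaws (Λ : Set (ProbabilityMeasure E)) : Prop :=
  Convex ℝ≥0 ((fun P : ProbabilityMeasure E => (P : Measure E)) '' Λ)

/-- `(G ⊕ H) (x₀, x₁) = G x₀ + H x₁`. -/
def directSum (G H : E → ℝ) : E × E → ℝ := fun z => G z.1 + H z.2

/-- The expectation `μ(Y⁺) - μ(Y⁻)` of an extended real function, where `∞ - ∞ = -∞`
(which is the convention of subtraction in `EReal`). -/
def expect (μ : Measure E) (Y : E → EReal) : EReal :=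
  ((∫⁻ x, (Y x).toENNReal ∂μ : ℝ≥0∞) : EReal) - ((∫⁻ x, (-Y x).toENNReal ∂μ : ℝ≥0∞) : EReal)

end Weights

/-! ### Constrained laws on a path space `Ω` with initial value `X₀` and terminal value `XT` -/

section Laws

variable {Ω E : Type*} [TopologicalSpace Ω] [MeasurableSpace Ω] [BorelSpace Ω]
  [TopologicalSpace E] [MeasurableSpace E]

/-- `Γ` assigns to each `x` a nonempty set of laws on `Ω` carried by `{X₀ = x}`, and the graph
of `Γ` is an analytic subset of `E × 𝔓(Ω)`, with the weak topology on `𝔓(Ω)`. -/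
structure IsConstraint (X₀ : Ω → E) (Γ : E → Set (ProbabilityMeasure Ω)) : Prop where
  nonempty : ∀ x, (Γ x).Nonempty
  starts_at : ∀ x, ∀ Q ∈ Γ x, ∀ᵐ ω ∂(Q : Measure Ω), X₀ ω = x
  analytic : AnalyticSet {p : E × ProbabilityMeasure Ω | p.2 ∈ Γ p.1}

/-- The laws `P` on `Ω` under which the random variable `Y` has law `α`. -/
def lawsWithMarginal (Y : Ω → E) (α : ProbabilityMeasure E) : Set (ProbabilityMeasure Ω) :=
  {P | (P : Measure Ω).map Y = (α : Measure E)}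

/-- The Markov kernel `κ` is a regular conditional law of `ω` given `X₀` under `P`: the joint law
of `(X₀ ω, ω)` disintegrates as `(law of X₀) ⊗ κ`. -/
def IsCondLaw (X₀ : Ω → E) (P : Measure Ω) (κ : Kernel E Ω) : Prop :=
  P.map (fun ω => (X₀ ω, ω)) = (P.map X₀) ⊗ₘ κ

/-- The laws `P` whose conditional law given `X₀ = x` belongs to `Γ x`, for almost every `x` with
respect to the law of `X₀`. -/
def constrainedLaws (X₀ : Ω → E) (Γ : E → Set (ProbabilityMeasure Ω)) :
    Set (ProbabilityMeasure Ω) :=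
  {P | ∃ (κ : Kernel E Ω) (_ : IsMarkovKernel κ), IsCondLaw X₀ (P : Measure Ω) κ ∧
    ∀ᵐ x ∂((P : Measure Ω).map X₀), (⟨κ x, inferInstance⟩ : ProbabilityMeasure Ω) ∈ Γ x}

/-- The joint laws of `(X₀, XT)` under the members of a set of laws on `Ω`. -/
def jointLaws (X₀ XT : Ω → E) (S : Set (ProbabilityMeasure Ω)) :
    Set (ProbabilityMeasure (E × E)) :=
  {R | ∃ P ∈ S, (R : Measure (E × E)) = (P : Measure Ω).map (fun ω => (X₀ ω, XT ω))}

/-- `f^Γ (x) = inf_{Q ∈ Γ x} E^Q[f(XT)]`, in the extended reals. -/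
def lowerEnvelope (XT : Ω → E) (Γ : E → Set (ProbabilityMeasure Ω)) (f : E → ℝ) (x : E) : EReal :=
  ⨅ Q ∈ Γ x, expect (Q : Measure Ω) (fun ω => (f (XT ω) : EReal))

end Laws

/-! ### Continuous paths -/

instance instMeasurableSpaceContinuousPath {E : Type*} [TopologicalSpace E] :
    MeasurableSpace C(I, E) := borel _

instance instBorelSpaceContinuousPath {E : Type*} [TopologicalSpace E] :
    BorelSpace C(I, E) := ⟨rfl⟩

/-! ### Right continuous paths with left limits -/

/-- The space `D[0,1]` of right continuous functions with left limits from `[0,1]` to `E`. -/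
structure SkorokhodPath (E : Type*) [TopologicalSpace E] where
  toFun : I → E
  right_continuous : ∀ t, ContinuousWithinAt toFun (Set.Ici t) t
  left_limit : ∀ t, ∃ l, Tendsto toFun (𝓝[<] t) (𝓝 l)

namespace SkorokhodPath

instance {E : Type*} [TopologicalSpace E] : CoeFun (SkorokhodPath E) (fun _ => I → E) :=
  ⟨SkorokhodPath.toFun⟩

variable {E : Type*} [PseudoEMetricSpace E]

/-- The cost `max (sup |λ t - t|, sup d(f (λ t), g t))` of a time change `λ`. -/
def cost (f g : SkorokhodPath E) (lam : I ≃o I) : ℝ≥0∞ :=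
  max (⨆ t, edist (lam t) t) (⨆ t, edist (f (lam t)) (g t))

/-- The Skorokhod metric: the infimum of the cost over all increasing bijections of `[0,1]`. -/
instance : PseudoEMetricSpace (SkorokhodPath E) where
  edist f g := ⨅ lam : I ≃o I, cost f g lam
  edist_self f := by
    refine le_antisymm (iInf_le_of_le (OrderIso.refl I) ?_) bot_le
    simp [cost]
  edist_comm := by
    have key : ∀ f g : SkorokhodPath E,
        (⨅ lam : I ≃o I, cost f g lam) ≤ ⨅ lam : I ≃o I, cost g f lam := by
      intro f g
      refine le_iInf fun lam => iInf_le_of_le lam.symm ?_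
      refine max_le_max (iSup_le fun t => ?_) (iSup_le fun t => ?_)
      · refine le_iSup_of_le (lam.symm t) ?_
        rw [lam.apply_symm_apply, edist_comm]
      · refine le_iSup_of_le (lam.symm t) ?_
        rw [lam.apply_symm_apply, edist_comm]
    exact fun f g => le_antisymm (key f g) (key g f)
  edist_triangle f g h := by
    refine ENNReal.le_iInf_add_iInf fun lam mu => ?_
    refine iInf_le_of_le (mu.trans lam) (max_le (iSup_le fun t => ?_) (iSup_le fun t => ?_))
    · refine (edist_triangle _ (mu t) _).trans (add_le_add ?_ ?_)
      · exact (le_iSup (fun s => edist (lam s) s) (mu t)).trans (le_max_left _ _)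
      · exact (le_iSup (fun s => edist (mu s) s) t).trans (le_max_left _ _)
    · refine (edist_triangle _ (g (mu t)) _).trans (add_le_add ?_ ?_)
      · exact (le_iSup (fun s => edist (f (lam s)) (g s)) (mu t)).trans (le_max_right _ _)
      · exact (le_iSup (fun s => edist (g (mu s)) (h s)) t).trans (le_max_right _ _)

instance : MeasurableSpace (SkorokhodPath E) := borel _

instance : BorelSpace (SkorokhodPath E) := ⟨rfl⟩

end SkorokhodPath

end ConstrainedTransport

end

open ConstrainedTransport

/-! Necessity is conditioning: under an admissible law, the integral of `f` against `β` is the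
`α`-average of conditional expectations of `f (XT)`, and almost every one of them is at least the
lower envelope.

For sufficiency, let `M` be the convex set of terminal laws with finite `H`-moment coming from `A ∩
C`. Either `β` is a limit of a sequence in `M`, weakly and with `H`-moments, or Hahn–Banach
separates it from `M` by a function of the weighted class (`exists_separating_or_tendsto`).

Separation is impossible. The separating function can be made to dominate `ε H`
(`exists_separating_dominating`), and measurable selection (`exists_law_lintegral_lt`) yields a law
in `A ∩ C` that nearly attains the `α`-integral of its envelope. The assumed inequality puts this
value below the separating level, while domination puts the terminal law in `M`: a contradiction.

In the case of a limit, the joint endpoint laws have first marginal `α` and convergent second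
marginals, so they are tight. A subsequential limit couples `α` with `β`, and `J`-closedness
realises it by a law in `A ∩ C`.

All limits are taken on `E` and `E × E`. The path space enters only through measurable endpoints and
the approximation of closed sets by continuous functions, which allows one proof for the three
cases. -/

namespace ConstrainedTransport

/-! ### Capacitability, analytic sets and measurable selection -/

section Selection

/-- The members of `T x` with least `k`-th term. -/
def leastTerm {E : Type*} (T : E → Set (ℕ → ℕ)) (k : ℕ) (x : E) : Set (ℕ → ℕ) :=
  {a ∈ T x | a k = sInf ((fun b : ℕ → ℕ => b k) '' T x)}

/-- The least `k`-th term is `m` when `m` is attained and no smaller value is. Fixing a term is a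
closed condition, so the hitting set is a countable Boolean combination of hitting sets of `T`. -/
theorem measurableSet_leastTerm_hits {E : Type*} [MeasurableSpace E] {T : E → Set (ℕ → ℕ)}
    (hT : ∀ F, IsClosed F → MeasurableSet {x | (T x ∩ F).Nonempty}) (k : ℕ)
    {F : Set (ℕ → ℕ)} (hF : IsClosed F) :
    MeasurableSet {x | (leastTerm T k x ∩ F).Nonempty} := by
  have hcl : ∀ m, IsClosed {a : ℕ → ℕ | a k = m} := fun m =>
    isClosed_eq (continuous_apply k) continuous_const
  have : {x | (leastTerm T k x ∩ F).Nonempty} = ⋃ m, ({x | (T x ∩ (F ∩ {a | a k = m})).Nonempty} ∩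
      ⋂ j, ⋂ (_ : j < m), {x | (T x ∩ {a | a k = j}).Nonempty}ᶜ) := by
    ext x
    simp only [Set.mem_ofPred_eq, Set.mem_iUnion, Set.mem_inter_iff, Set.mem_iInter,
      Set.mem_compl_iff]
    constructor
    · rintro ⟨a, ⟨haT, hak⟩, haF⟩
      refine ⟨a k, ⟨a, haT, haF, rfl⟩, ?_⟩
      rintro j hj ⟨b, hbT, hbj : b k = j⟩
      have : a k ≤ b k := hak ▸ Nat.sInf_le ⟨b, hbT, rfl⟩
      omega
    · rintro ⟨m, ⟨a, haT, haF, ham : a k = m⟩, hlow⟩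
      refine ⟨a, ⟨haT, le_antisymm ?_ (Nat.sInf_le ⟨a, haT, rfl⟩)⟩, haF⟩
      refine le_csInf ⟨_, ⟨a, haT, rfl⟩⟩ ?_
      rintro _ ⟨b, hbT, rfl⟩
      by_contra! hlt
      exact hlow (b k) (hlt.trans_eq ham) ⟨b, hbT, rfl⟩
  rw [this]
  exact MeasurableSet.iUnion fun m => (hT _ (hF.inter (hcl m))).inter <|
    MeasurableSet.iInter fun j => MeasurableSet.iInter fun _ => (hT _ (hcl j)).compl

variable {E : Type*} [TopologicalSpace E] [PolishSpace E] [MeasurableSpace E] [BorelSpace E]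

/-- The box of all sequences bounded termwise by `n`. -/
def sequenceBox (n : ℕ → ℕ) : Set (ℕ → ℕ) := {a | ∀ i, a i ≤ n i}

theorem isCompact_sequenceBox (n : ℕ → ℕ) : IsCompact (sequenceBox n) := by
  have h : sequenceBox n = Set.pi Set.univ fun i => Set.Iic (n i) := by
    ext a; simp [sequenceBox, Pi.le_def]
  rw [h]
  exact isCompact_univ_pi fun i => (Set.finite_Iic (n i)).isCompact

/-- An open set containing a box contains one of its finite stages. -/
theorem exists_stage_subset {n : ℕ → ℕ} {U : Set (ℕ → ℕ)} (hU : IsOpen U)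
    (hn : sequenceBox n ⊆ U) : ∃ k, {a : ℕ → ℕ | ∀ i < k, a i ≤ n i} ⊆ U := by
  by_contra! hcon
  choose a ha haU using fun k => Set.not_subset.1 (hcon k)
  -- The truncations lie in the box, and each coordinate of `a k` is eventually untouched by
  -- truncation, so both sequences have the same limit along `φ`.
  obtain ⟨b, hb, φ, hφ, hlim⟩ := (isCompact_sequenceBox n).tendsto_subseq
    (x := fun k i => min (a k i) (n i)) (fun k i => min_le_right _ _)
  have hlim' : Tendsto (a ∘ φ) atTop (𝓝 b) := by
    rw [tendsto_pi_nhds] at hlim ⊢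
    intro i
    refine (hlim i).congr' ?_
    filter_upwards [eventually_gt_atTop i] with k hk
    exact min_eq_left (ha (φ k) i (hk.trans_le (hφ.id_le k)))
  obtain ⟨k, hk⟩ := (hlim'.eventually (hU.mem_nhds (hn hb))).exists
  exact haU (φ k) hk

/-- Capacitability: the image of the Baire space is approximated from inside, in outer measure,
by images of compact boxes. -/
theorem exists_sequenceBox_measure_le {π : (ℕ → ℕ) → E} (hπ : Continuous π) (μ : Measure E)
    [IsFiniteMeasure μ] {ε : ℝ≥0∞} (hε : ε ≠ 0) :
    ∃ n : ℕ → ℕ, μ (Set.range π) ≤ μ (π '' sequenceBox n) + ε := by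
  obtain ⟨δ, hδ, hδε⟩ := ENNReal.exists_pos_sum_of_countable' hε ℕ
  have step : ∀ (S : Set (ℕ → ℕ)) (k : ℕ), ∃ m,
      μ (π '' S) ≤ μ (π '' (S ∩ {a | a k ≤ m})) + δ k := by
    intro S k
    have hmono : Monotone fun m => π '' (S ∩ {a : ℕ → ℕ | a k ≤ m}) := fun m m' h =>
      Set.image_mono (Set.inter_subset_inter_right _ fun a (ha : a k ≤ m) => ha.trans h)
    have hU : π '' S = ⋃ m, π '' (S ∩ {a : ℕ → ℕ | a k ≤ m}) := by
      rw [← Set.image_iUnion, ← Set.inter_iUnion]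
      congr 1
      exact (Set.inter_eq_left.2 fun a _ => Set.mem_iUnion.2 ⟨a k, le_refl (a k)⟩).symm
    -- The images need not be measurable; continuity from below along a monotone sequence holds for
    -- the outer measure.
    have hlim := (tendsto_measure_iUnion_atTop (μ := μ) hmono).add_const (δ k)
    rw [← hU] at hlim
    have hlt : μ (π '' S) < μ (π '' S) + δ k :=
      ENNReal.lt_add_right (measure_ne_top _ _) (hδ k).ne'
    obtain ⟨m, hm⟩ := (hlim.eventually (lt_mem_nhds hlt)).exists
    exact ⟨m, hm.le⟩
  choose m hm using step
  -- Stage `k` bounds one more coordinate, at a cost of at most `δ k` in outer measure.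
  let S : ℕ → Set (ℕ → ℕ) := fun k =>
    Nat.rec Set.univ (fun k S => S ∩ {a | a k ≤ m S k}) k
  have hS : ∀ k, S k = {a | ∀ i < k, a i ≤ m (S i) i} := by
    intro k
    induction k with
    | zero => simp [S]
    | succ k ih =>
      change S k ∩ {a | a k ≤ m (S k) k} = _
      rw [ih]
      ext a
      simp only [Set.mem_inter_iff, Set.mem_ofPred_eq, Nat.lt_succ_iff_lt_or_eq]
      rw [← ih]
      constructor
      · rintro ⟨h1, h2⟩ i (hi | rfl)
        · exact h1 i hi
        · exact h2
      · exact fun h => ⟨fun i hi => h i (Or.inl hi), h k (Or.inr rfl)⟩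
  have hsum : ∀ k, μ (Set.range π) ≤ μ (π '' S k) + ∑ i ∈ Finset.range k, δ i := by
    intro k
    induction k with
    | zero => simp [S]
    | succ k ih =>
      refine ih.trans ?_
      rw [Finset.sum_range_succ, add_comm (∑ i ∈ Finset.range k, δ i), ← add_assoc]
      gcongr
      exact hm (S k) k
  refine ⟨fun i => m (S i) i, ?_⟩
  refine ENNReal.le_of_forall_pos_le_add fun η hη _ => ?_
  -- Continuity from above is not available for the images of the stages. An open superset of the
  -- image of the box replaces it, since its preimage already contains a finite stage.
  obtain ⟨U, hKU, hU, hμU⟩ := (π '' sequenceBox fun i => m (S i) i).exists_isOpen_lt_add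
    (measure_ne_top μ _) (ENNReal.coe_ne_zero.2 hη.ne')
  obtain ⟨k, hk⟩ := exists_stage_subset (hU.preimage hπ) (Set.image_subset_iff.1 hKU)
  calc μ (Set.range π) ≤ μ (π '' S k) + ∑ i ∈ Finset.range k, δ i := hsum k
    _ ≤ μ U + ε := by
        gcongr
        · rw [hS k]; exact Set.image_subset_iff.2 hk
        · exact (ENNReal.sum_le_tsum _).trans hδε.le
    _ ≤ _ := by
        rw [add_right_comm]
        gcongr

/-- The image of the Baire space under a continuous map is exhausted, up to a null set, by a
sequence of images of compact boxes. -/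
theorem exists_sequenceBox_ae {π : (ℕ → ℕ) → E} (hπ : Continuous π) (μ : Measure E)
    [IsFiniteMeasure μ] :
    ∃ n : ℕ → ℕ → ℕ, (⋃ j, π '' sequenceBox (n j)) =ᵐ[μ] Set.range π := by
  choose n hn using fun j : ℕ => exists_sequenceBox_measure_le hπ μ
    (ε := ((j : ℝ≥0∞) + 1)⁻¹) (by simp)
  refine ⟨n, ae_eq_of_subset_of_measure_ge
    (Set.iUnion_subset fun j => Set.image_subset_range _ _) ?_ ?_ (measure_ne_top _ _)⟩
  · refine ENNReal.le_of_forall_pos_le_add fun η hη _ => ?_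
    obtain ⟨j, hj⟩ := ENNReal.exists_inv_nat_lt (ENNReal.coe_ne_zero.2 hη.ne')
    refine (hn j).trans (add_le_add (measure_mono (Set.subset_iUnion_of_subset j subset_rfl)) ?_)
    exact (ENNReal.inv_le_inv.2 le_self_add).trans hj.le
  · exact (MeasurableSet.iUnion fun j =>
      ((isCompact_sequenceBox _).image hπ).measurableSet).nullMeasurableSet

/-- Analytic sets are universally measurable. -/
theorem analyticSet_nullMeasurableSet {A : Set E} (hA : AnalyticSet A) (μ : Measure E)
    [IsFiniteMeasure μ] : NullMeasurableSet A μ := by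
  rw [AnalyticSet] at hA
  rcases hA with rfl | ⟨π, hπ, rfl⟩
  · exact MeasurableSet.empty.nullMeasurableSet
  · obtain ⟨n, hn⟩ := exists_sequenceBox_ae hπ μ
    exact (MeasurableSet.iUnion fun j =>
      ((isCompact_sequenceBox _).image hπ).measurableSet).nullMeasurableSet.congr hn

/-- A continuous map on a compact set of sequences has a Borel right inverse: the
lexicographically least preimage. -/
theorem exists_measurable_rightInverse_of_isCompact {π : (ℕ → ℕ) → E} (hπ : Continuous π)
    {K : Set (ℕ → ℕ)} (hK : IsCompact K) :
    ∃ s : E → ℕ → ℕ, Measurable s ∧ ∀ x ∈ π '' K, s x ∈ K ∧ π (s x) = x := by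
  -- Within each fibre, successive minimisation of the coordinates leaves only the lexicographically
  -- least point.
  let T : ℕ → E → Set (ℕ → ℕ) := fun k =>
    Nat.rec (fun x => K ∩ π ⁻¹' {x}) (fun k T => leastTerm T k) k
  have hT : ∀ k F, IsClosed F → MeasurableSet {x | (T k x ∩ F).Nonempty} := by
    intro k
    induction k with
    | zero =>
      intro F hF
      have : {x | (T 0 x ∩ F).Nonempty} = π '' (K ∩ F) := by
        ext x
        constructor
        · rintro ⟨a, ⟨h1, h2⟩, h3⟩; exact ⟨a, ⟨h1, h3⟩, h2⟩
        · rintro ⟨a, ⟨h1, h3⟩, h2⟩; exact ⟨a, ⟨h1, h2⟩, h3⟩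
      rw [this]
      exact ((hK.inter_right hF).image hπ).measurableSet
    | succ k ih => exact fun F hF => measurableSet_leastTerm_hits ih k hF
  have hanti : ∀ k x, T (k + 1) x ⊆ T k x := fun k x a ha => ha.1
  have hcomp : ∀ k x, IsClosed (T k x) := by
    intro k x
    induction k with
    | zero => exact hK.isClosed.inter (isClosed_singleton.preimage hπ)
    | succ k ih => exact ih.inter (isClosed_eq (continuous_apply k) continuous_const)
  let s : E → ℕ → ℕ := fun x k => sInf ((fun b : ℕ → ℕ => b k) '' T k x)
  refine ⟨s, ?_, ?_⟩
  · refine measurable_pi_lambda _ fun k => measurable_to_countable' fun m => ?_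
    have hcl : ∀ m, IsClosed {a : ℕ → ℕ | a k = m} := fun m =>
      isClosed_eq (continuous_apply k) continuous_const
    -- The second piece accounts for the default `sInf ∅ = 0` over empty fibres.
    have : (fun x => s x k) ⁻¹' {m} =
        {x | (T (k + 1) x ∩ {a | a k = m}).Nonempty} ∪
          ({x | (T k x ∩ Set.univ).Nonempty}ᶜ ∩ {_x | m = 0}) := by
      ext x
      simp only [Set.mem_preimage, Set.mem_singleton_iff, Set.mem_union, Set.mem_ofPred_eq,
        Set.mem_inter_iff, Set.mem_compl_iff, Set.inter_univ]
      by_cases hne : (T k x).Nonempty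
      · obtain ⟨b, hb, hbk⟩ := Nat.sInf_mem (hne.image fun b : ℕ → ℕ => b k)
        constructor
        · exact fun h => Or.inl ⟨b, ⟨hb, hbk⟩, hbk.trans h⟩
        · rintro (⟨a, ⟨_, ha⟩, ham : a k = m⟩ | ⟨h, _⟩)
          · exact ha.symm.trans ham
          · exact absurd hne h
      · have h0 : s x k = 0 := by
          simp [s, Set.not_nonempty_iff_eq_empty.1 hne]
        rw [h0]
        constructor
        · exact fun h => Or.inr ⟨hne, h.symm⟩
        · rintro (⟨a, ha, _⟩ | ⟨_, h⟩)
          · exact absurd ⟨a, hanti k x ha⟩ hne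
          · exact h.symm
    rw [this]
    exact (hT (k + 1) _ (hcl m)).union ((hT k _ isClosed_univ).compl.inter (MeasurableSet.const _))
  · intro x hx
    have hne : ∀ k, (T k x).Nonempty := by
      intro k
      induction k with
      | zero => obtain ⟨a, ha, hax⟩ := hx; exact ⟨a, ha, hax⟩
      | succ k ih =>
        obtain ⟨b, hb, hbk⟩ := Nat.sInf_mem (ih.image fun b : ℕ → ℕ => b k)
        exact ⟨b, hb, hbk⟩
    obtain ⟨a, ha⟩ := IsCompact.nonempty_iInter_of_sequence_nonempty_isCompact_isClosed
      (fun k => T k x) (fun k => hanti k x) hne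
      (hK.of_isClosed_subset (hcomp 0 x) Set.inter_subset_left) (fun k => hcomp k x)
    rw [Set.mem_iInter] at ha
    have has : a = s x := funext fun k => (ha (k + 1)).2
    rw [← has]
    exact ha 0

/-- A continuous map on the Baire space has, up to a null set, a Borel right inverse. -/
theorem exists_measurable_rightInverse {π : (ℕ → ℕ) → E} (hπ : Continuous π) (μ : Measure E)
    [IsFiniteMeasure μ] :
    ∃ s : E → ℕ → ℕ, Measurable s ∧ ∀ᵐ x ∂μ, x ∈ Set.range π → π (s x) = x := by
  classical
  obtain ⟨n, hn⟩ := exists_sequenceBox_ae hπ μ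
  choose s hs hsx using fun j =>
    exists_measurable_rightInverse_of_isCompact hπ (isCompact_sequenceBox (n j))
  have hm : ∀ j, MeasurableSet (π '' sequenceBox (n j)) := fun j =>
    ((isCompact_sequenceBox _).image hπ).measurableSet
  -- The second alternative makes the search for an index succeed off the union as well.
  let p : ℕ → E → Prop := fun j x =>
    x ∈ π '' sequenceBox (n j) ∨ x ∉ ⋃ j, π '' sequenceBox (n j)
  have hp : ∀ x, ∃ j, p j x := by
    intro x
    by_cases hx : x ∈ ⋃ j, π '' sequenceBox (n j)
    · obtain ⟨j, hj⟩ := Set.mem_iUnion.1 hx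
      exact ⟨j, Or.inl hj⟩
    · exact ⟨0, Or.inr hx⟩
  have hpm : ∀ j, MeasurableSet {x | p j x} := fun j =>
    (hm j).union (MeasurableSet.iUnion hm).compl
  refine ⟨fun x => s (Nat.find (hp x)) x, Measurable.find hs hpm hp, ?_⟩
  filter_upwards [hn.mem_iff] with x hx hxr
  have h := Nat.find_spec (hp x)
  exact (hsx _ x (h.resolve_right fun h' => h' (hx.2 hxr))).2

/-- Measurable selection: a Borel subset `S` of the Baire space admits, up to a null set, a Borel
section of a continuous map `π` over `π '' S`. -/
theorem exists_measurable_section {π : (ℕ → ℕ) → E} (hπ : Continuous π) {S : Set (ℕ → ℕ)}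
    (hS : MeasurableSet S) (μ : Measure E) [IsFiniteMeasure μ] :
    ∃ s : E → ℕ → ℕ, Measurable s ∧ ∀ᵐ x ∂μ, x ∈ π '' S → s x ∈ S ∧ π (s x) = x := by
  have hA := hS.analyticSet
  rw [AnalyticSet] at hA
  rcases hA with rfl | ⟨ψ, hψ, rfl⟩
  · exact ⟨fun _ => 0, measurable_const, by simp⟩
  · obtain ⟨s, hs, hsx⟩ := exists_measurable_rightInverse (hπ.comp hψ) μ
    refine ⟨ψ ∘ s, hψ.measurable.comp hs, ?_⟩
    filter_upwards [hsx] with x hx hxr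
    exact ⟨⟨s x, rfl⟩, hx (by rwa [Set.range_comp])⟩

end Selection

/-! ### Mixtures of kernels and nearly optimal constrained laws -/

section OptimalLaws

/-- If the law `κ x` is carried by `{X₀ = x}`, then `κ` is the conditional law given `X₀` under the
mixture of `κ` by `α`, and that mixture has initial law `α`. -/
theorem isCondLaw_mixture {Ω E : Type*} [MeasurableSpace Ω] [TopologicalSpace E]
    [PolishSpace E] [MeasurableSpace E] [BorelSpace E] {X₀ : Ω → E} (hX₀ : Measurable X₀)
    (α : Measure E)
    [IsProbabilityMeasure α] (κ : Kernel E Ω) [IsMarkovKernel κ]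
    (hκ : ∀ᵐ x ∂α, ∀ᵐ ω ∂(κ x), X₀ ω = x) :
    ((α ⊗ₘ κ).snd).map X₀ = α ∧ IsCondLaw X₀ (α ⊗ₘ κ).snd κ := by
  have hae : ∀ᵐ z ∂(α ⊗ₘ κ), X₀ z.2 = z.1 :=
    Measure.ae_compProd_of_ae_ae
      (measurableSet_eq_fun (hX₀.comp measurable_snd) measurable_fst) hκ
  have hjoint : ((α ⊗ₘ κ).snd).map (fun ω => (X₀ ω, ω)) = α ⊗ₘ κ := by
    rw [Measure.snd, Measure.map_map (hX₀.prodMk measurable_id') measurable_snd]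
    conv_rhs => rw [← Measure.map_id (μ := α ⊗ₘ κ)]
    refine Measure.map_congr ?_
    filter_upwards [hae] with z hz
    exact Prod.ext hz rfl
  have hmarg : ((α ⊗ₘ κ).snd).map X₀ = α := by
    have h := congrArg Measure.fst hjoint
    rw [Measure.fst_compProd, Measure.fst,
      Measure.map_map measurable_fst (hX₀.prodMk measurable_id')] at h
    exact h
  refine ⟨hmarg, ?_⟩
  rw [IsCondLaw, hmarg, hjoint]

variable {Ω E : Type*} [TopologicalSpace Ω] [MeasurableSpace Ω] [BorelSpace Ω]
  [HasOuterApproxClosed Ω]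

/-- A weakly continuous family of probability measures is a measurable family of measures. -/
theorem measurable_coe_of_continuous {Z : Type*} [TopologicalSpace Z] [MeasurableSpace Z]
    [OpensMeasurableSpace Z] {φ : Z → ProbabilityMeasure Ω} (hφ : Continuous φ) :
    Measurable fun z => (φ z : Measure Ω) := by
  refine Measurable.measure_of_isPiSystem_of_isProbabilityMeasure
    (S := {s : Set Ω | IsClosed s}) ?_ isPiSystem_isClosed fun F hF => ?_
  · rw [BorelSpace.measurable_eq (α := Ω), borel_eq_generateFrom_isClosed]
  · refine measurable_of_tendsto_metrizable
      (f := fun n z => ∫⁻ ω, (IsClosed.apprSeq hF n ω : ℝ≥0∞) ∂(φ z : Measure Ω)) (fun n => ?_)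
      (tendsto_pi_nhds.2 fun z => ?_)
    · exact ((ProbabilityMeasure.continuous_lintegral_boundedContinuousFunction
        (IsClosed.apprSeq hF n)).comp hφ).measurable
    · exact HasOuterApproxClosed.tendsto_lintegral_apprSeq hF _

variable [TopologicalSpace E] [PolishSpace E] [MeasurableSpace E] [BorelSpace E]

/-- The integral of the infimum of `Q(h)` over `Q ∈ Γ x` is approached by constrained laws with
initial law `α`. -/
theorem exists_law_lintegral_lt {X₀ : Ω → E} (hX₀ : Measurable X₀)
    {Γ : E → Set (ProbabilityMeasure Ω)} (hΓ : IsConstraint X₀ Γ) (α : ProbabilityMeasure E)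
    {h : Ω → ℝ≥0∞} (hh : Measurable h) {c : ℝ≥0∞}
    (hc : ∫⁻ x, ⨅ Q ∈ Γ x, ∫⁻ ω, h ω ∂(Q : Measure Ω) ∂(α : Measure E) < c) :
    ∃ P ∈ lawsWithMarginal X₀ α ∩ constrainedLaws X₀ Γ, ∫⁻ ω, h ω ∂(P : Measure Ω) < c := by
  obtain ⟨φ, hφ, hrange⟩ : ∃ φ : (ℕ → ℕ) → E × ProbabilityMeasure Ω, Continuous φ ∧
      Set.range φ = {p : E × ProbabilityMeasure Ω | p.2 ∈ Γ p.1} := by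
    have hA := hΓ.analytic
    rw [AnalyticSet] at hA
    refine hA.resolve_left fun hemp => ?_
    obtain ⟨x⟩ := (α : Measure E).nonempty_of_neZero
    obtain ⟨Q, hQ⟩ := hΓ.nonempty x
    exact (hemp ▸ (show (x, Q) ∈ {p : E × ProbabilityMeasure Ω | p.2 ∈ Γ p.1} from hQ) :
      (x, Q) ∈ (∅ : Set _))
  have hmem : ∀ z, (φ z).2 ∈ Γ (φ z).1 := fun z => hrange.subset ⟨z, rfl⟩
  have hex : ∀ x, ∀ Q ∈ Γ x, ∃ z, φ z = (x, Q) := fun x Q hQ => hrange.superset hQ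
  let g : E → ℝ≥0∞ := fun x => ⨅ Q ∈ Γ x, ∫⁻ ω, h ω ∂(Q : Measure Ω)
  have hκ₀ : Measurable fun z => ((φ z).2 : Measure Ω) :=
    measurable_coe_of_continuous (continuous_snd.comp hφ)
  let F : (ℕ → ℕ) → ℝ≥0∞ := fun z => ∫⁻ ω, h ω ∂((φ z).2 : Measure Ω)
  have hF : Measurable F := (Measure.measurable_lintegral hh).comp hκ₀
  have hπ : Continuous fun z => (φ z).1 := continuous_fst.comp hφ
  have hg : AEMeasurable g (α : Measure E) := by
    have : NullMeasurable g (α : Measure E) := by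
      refine measurable_of_Iio fun b => ?_
      -- A strict bound on an infimum is an existence statement, so the sublevel set is a continuous
      -- image of a Borel set, hence analytic.
      have himg : g ⁻¹' Set.Iio b = (fun z => (φ z).1) '' {z | F z < b} := by
        ext x
        simp only [Set.mem_preimage, Set.mem_Iio, g, iInf_lt_iff, Set.mem_image, Set.mem_ofPred_eq]
        constructor
        · rintro ⟨Q, hQ, hlt⟩
          obtain ⟨z, hz⟩ := hex x Q hQ
          exact ⟨z, by simpa [F, hz] using hlt, by simp [hz]⟩
        · rintro ⟨z, hz, rfl⟩
          exact ⟨(φ z).2, hmem z, hz⟩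
      exact himg ▸ analyticSet_nullMeasurableSet
        ((measurableSet_lt hF measurable_const).analyticSet.image_of_continuous hπ) α
    exact this.aemeasurable
  obtain ⟨δ, hδ, hδc⟩ : ∃ δ : ℝ≥0∞, 0 < δ ∧ ∫⁻ x, g x ∂(α : Measure E) + δ < c := by
    obtain ⟨r, hr, hrc⟩ := ENNReal.lt_iff_exists_add_pos_lt.1 hc
    exact ⟨r, ENNReal.coe_pos.2 hr, hrc⟩
  -- The Borel version of `g` makes `S` a Borel set, as the selection theorem requires.
  let S : Set (ℕ → ℕ) := {z | F z ≤ hg.mk g (φ z).1 + δ}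
  have hS : MeasurableSet S := measurableSet_le hF
    ((hg.measurable_mk.comp hπ.measurable).add measurable_const)
  obtain ⟨s, hs, hsx⟩ := exists_measurable_section hπ hS (α : Measure E)
  have hsel : ∀ᵐ x ∂(α : Measure E), F (s x) ≤ g x + δ ∧ (φ (s x)).1 = x := by
    filter_upwards [hsx, hg.ae_eq_mk] with x hx hgx
    have hxS : x ∈ (fun z => (φ z).1) '' S := by
      -- At an infinite value there is no strict inequality `g x < g x + δ`, but every law in `Γ x`
      -- is then admissible.
      by_cases htop : g x = ∞
      · obtain ⟨Q, hQ⟩ := hΓ.nonempty x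
        obtain ⟨z, hz⟩ := hex x Q hQ
        exact ⟨z, by simp [S, hz, ← hgx, htop], by simp [hz]⟩
      · have hlt : g x < g x + δ := ENNReal.lt_add_right htop hδ.ne'
        simp only [g, iInf_lt_iff] at hlt
        obtain ⟨Q, hQ, hQlt⟩ := hlt
        obtain ⟨z, hz⟩ := hex x Q hQ
        refine ⟨z, ?_, by simp [hz]⟩
        change F z ≤ hg.mk g (φ z).1 + δ
        simp only [F, hz, ← hgx]
        exact hQlt.le
    obtain ⟨h1, h2⟩ := hx hxS
    have h1' : F (s x) ≤ hg.mk g (φ (s x)).1 + δ := h1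
    rw [h2, ← hgx] at h1'
    exact ⟨h1', h2⟩
  let κ : Kernel E Ω := ⟨fun x => ((φ (s x)).2 : Measure Ω), hκ₀.comp hs⟩
  have : IsMarkovKernel κ := ⟨fun x => (φ (s x)).2.prop⟩
  have hκΓ : ∀ᵐ x ∂(α : Measure E), (φ (s x)).2 ∈ Γ x := by
    filter_upwards [hsel] with x hx
    have := hmem (s x)
    rwa [hx.2] at this
  obtain ⟨hmarg, hcond⟩ := isCondLaw_mixture hX₀ (α : Measure E) κ
    (by filter_upwards [hκΓ] with x hx using hΓ.starts_at x _ hx)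
  refine ⟨⟨((α : Measure E) ⊗ₘ κ).snd, inferInstance⟩, ⟨hmarg, κ, inferInstance, hcond, ?_⟩, ?_⟩
  · rw [ProbabilityMeasure.coe_mk, hmarg]
    exact hκΓ
  · refine lt_of_le_of_lt ?_ hδc
    rw [ProbabilityMeasure.coe_mk, Measure.snd, lintegral_map hh measurable_snd,
      Measure.lintegral_compProd (f := fun z => h z.2) (hh.comp measurable_snd)]
    calc ∫⁻ x, ∫⁻ ω, h ω ∂(κ x) ∂(α : Measure E) ≤ ∫⁻ x, (g x + δ) ∂(α : Measure E) :=
          lintegral_mono_ae (by filter_upwards [hsel] with x hx using hx.1)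
      _ = _ := by rw [lintegral_add_right _ measurable_const]; simp

end OptimalLaws

/-! ### Extended expectations -/

section Expectation

variable {E : Type*} [MeasurableSpace E]

/-- Upper and lower parts are compared through `lintegral`, so no measurability is needed; this
matters because a lower envelope need not be Borel. -/
theorem expect_mono {μ : Measure E} {Y Z : E → EReal} (h : Y ≤ᵐ[μ] Z) :
    expect μ Y ≤ expect μ Z := by
  refine EReal.sub_le_sub ?_ ?_
  · refine EReal.coe_ennreal_le_coe_ennreal_iff.2 (lintegral_mono_ae ?_)
    filter_upwards [h] with x hx using EReal.toENNReal_le_toENNReal hx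
  · refine EReal.coe_ennreal_le_coe_ennreal_iff.2 (lintegral_mono_ae ?_)
    filter_upwards [h] with x hx using EReal.toENNReal_le_toENNReal (EReal.neg_le_neg_iff.2 hx)

theorem expect_coe_real {μ : Measure E} {r : E → ℝ} (hr : Integrable r μ) :
    expect μ (fun x => (r x : EReal)) = ((∫ x, r x ∂μ : ℝ) : EReal) := by
  have h1 : ∫⁻ x, ENNReal.ofReal (r x) ∂μ ≠ ∞ := hr.lintegral_lt_top.ne
  have h2 : ∫⁻ x, ENNReal.ofReal (-r x) ∂μ ≠ ∞ := hr.neg.lintegral_lt_top.ne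
  rw [integral_eq_lintegral_pos_part_sub_lintegral_neg_part hr, EReal.coe_sub,
    EReal.coe_ennreal_toReal h1, EReal.coe_ennreal_toReal h2]
  simp only [expect, ← EReal.coe_neg]
  congr

theorem expect_coe_ennreal {μ : Measure E} (g : E → ℝ≥0∞) :
    expect μ (fun x => (g x : EReal)) = ((∫⁻ x, g x ∂μ : ℝ≥0∞) : EReal) := by
  have h : ∀ x, (-(g x : EReal)).toENNReal = 0 := fun x =>
    EReal.toENNReal_of_nonpos (by
      rw [EReal.neg_le, neg_zero]
      exact EReal.coe_ennreal_nonneg _)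
  simp only [expect, h, EReal.toENNReal_coe, lintegral_zero, EReal.coe_ennreal_zero, sub_zero]

end Expectation

/-! ### The weighted function class as a vector space -/

section WeightedFunctions

variable {E : Type*} [TopologicalSpace E]

theorem mem_weightedFunctions_iff {H : E → ℝ} (hH : IsWeight H) {f : E → ℝ} :
    f ∈ weightedFunctions H ↔ Continuous f ∧ ∃ C, ∀ x, |f x| ≤ C * H x := by
  obtain ⟨c, hc, hcH⟩ := hH.2
  refine and_congr_right fun _ => ⟨?_, ?_⟩
  · rintro ⟨C, hC⟩
    exact ⟨C, fun x => (div_le_iff₀ (hc.trans_le (hcH x))).1 (hC ⟨x, rfl⟩)⟩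
  · rintro ⟨C, hC⟩
    refine ⟨C, ?_⟩
    rintro _ ⟨x, rfl⟩
    exact (div_le_iff₀ (hc.trans_le (hcH x))).2 (hC x)

theorem integrable_of_mem_weightedFunctions [MeasurableSpace E] [OpensMeasurableSpace E]
    {H : E → ℝ} (hH : IsWeight H) {f : E → ℝ} (hf : f ∈ weightedFunctions H) {μ : Measure E}
    (hμ : Integrable H μ) :
    Integrable f μ := by
  obtain ⟨hfc, C, hC⟩ := (mem_weightedFunctions_iff hH).1 hf
  exact (hμ.const_mul C).mono' hfc.measurable.aestronglyMeasurable (Eventually.of_forall hC)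

theorem add_mem_weightedFunctions {H : E → ℝ} (hH : IsWeight H) {f g : E → ℝ}
    (hf : f ∈ weightedFunctions H) (hg : g ∈ weightedFunctions H) :
    (fun x => f x + g x) ∈ weightedFunctions H := by
  rw [mem_weightedFunctions_iff hH] at *
  obtain ⟨hfc, C, hC⟩ := hf
  obtain ⟨hgc, D, hD⟩ := hg
  refine ⟨hfc.add hgc, C + D, fun x => ?_⟩
  rw [add_mul]
  exact (abs_add_le _ _).trans (add_le_add (hC x) (hD x))

theorem mul_mem_weightedFunctions {H : E → ℝ} (hH : IsWeight H) (c : ℝ) {f : E → ℝ}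
    (hf : f ∈ weightedFunctions H) : (fun x => c * f x) ∈ weightedFunctions H := by
  rw [mem_weightedFunctions_iff hH] at *
  obtain ⟨hfc, C, hC⟩ := hf
  refine ⟨hfc.const_mul c, |c| * C, fun x => ?_⟩
  rw [abs_mul, mul_assoc]
  exact mul_le_mul_of_nonneg_left (hC x) (abs_nonneg c)

theorem self_mem_weightedFunctions {H : E → ℝ} (hH : IsWeight H) : H ∈ weightedFunctions H := by
  obtain ⟨c, hc, hcH⟩ := hH.2
  exact (mem_weightedFunctions_iff hH).2
    ⟨hH.1, 1, fun x => by rw [one_mul, abs_of_pos (hc.trans_le (hcH x))]⟩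

theorem bounded_mem_weightedFunctions {H : E → ℝ} (hH : IsWeight H) {f : E → ℝ}
    (hf : Continuous f) {C : ℝ} (hC : ∀ x, |f x| ≤ C) : f ∈ weightedFunctions H := by
  obtain ⟨c, hc, hcH⟩ := hH.2
  refine (mem_weightedFunctions_iff hH).2 ⟨hf, C / c, fun x => (hC x).trans ?_⟩
  have hC0 : 0 ≤ C := (abs_nonneg _).trans (hC x)
  calc C = C / c * c := by field_simp
    _ ≤ C / c * H x := mul_le_mul_of_nonneg_left (hcH x) (by positivity)

theorem sum_mem_weightedFunctions {H : E → ℝ} (hH : IsWeight H) {ι : Type*} (s : Finset ι)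
    {f : ι → E → ℝ} (hf : ∀ i ∈ s, f i ∈ weightedFunctions H) :
    (fun x => ∑ i ∈ s, f i x) ∈ weightedFunctions H := by
  classical
  induction s using Finset.induction_on with
  | empty => 
    simpa using bounded_mem_weightedFunctions hH (f := fun _ => 0) (C := 0) continuous_const
      fun _ => by simp
  | insert i s hi ih =>
    simp only [Finset.sum_insert hi]
    exact add_mem_weightedFunctions hH (hf i (by simp)) (ih fun j hj => hf j (by simp [hj]))

end WeightedFunctions

/-! ### The necessary condition, by disintegration -/

section Necessity

variable {Ω E : Type*} [MeasurableSpace Ω] [MeasurableSpace E]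

/-- The necessary condition: the lower envelope of `f` has at most the expectation of `f` under the
terminal law of any admissible law. -/
theorem expect_lowerEnvelope_le {X₀ XT : Ω → E} (hX₀ : Measurable X₀) (hXT : Measurable XT)
    {Γ : E → Set (ProbabilityMeasure Ω)} {α β : ProbabilityMeasure E} {P : ProbabilityMeasure Ω}
    (hA : P ∈ lawsWithMarginal X₀ α) (hB : P ∈ lawsWithMarginal XT β)
    (hC : P ∈ constrainedLaws X₀ Γ) {f : E → ℝ} (hf : Integrable f (β : Measure E)) :
    expect (α : Measure E) (lowerEnvelope XT Γ f) ≤ ((∫ x, f x ∂(β : Measure E) : ℝ) : EReal) := by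
  obtain ⟨κ, hκ, hcond, hΓ⟩ := hC
  have hA' : (P : Measure Ω).map X₀ = (α : Measure E) := hA
  have hB' : (P : Measure Ω).map XT = (β : Measure E) := hB
  rw [IsCondLaw, hA'] at hcond
  rw [hA'] at hΓ
  have hpair : Measurable fun ω => (X₀ ω, ω) := hX₀.prodMk measurable_id'
  have hm : Measurable fun z : E × Ω => XT z.2 := hXT.comp measurable_snd
  have hβ : ((α : Measure E) ⊗ₘ κ).map (fun z => XT z.2) = (β : Measure E) := by
    rw [← hcond, Measure.map_map hm hpair]
    exact hB'
  have hInt : Integrable (fun z : E × Ω => f (XT z.2)) ((α : Measure E) ⊗ₘ κ) := by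
    rw [← hβ] at hf
    exact hf.comp_measurable hm
  have hβf : ∫ x, f x ∂(β : Measure E)
      = ∫ x, ∫ ω, f (XT ω) ∂(κ x) ∂(α : Measure E) := by
    rw [← Measure.integral_compProd hInt, ← hβ, integral_map hm.aemeasurable]
    rw [hβ]; exact hf.aestronglyMeasurable
  have hInt' := (Measure.integrable_compProd_iff hInt.aestronglyMeasurable).1 hInt
  rw [hβf, ← expect_coe_real]
  · refine expect_mono ?_
    filter_upwards [hΓ, hInt'.1] with x hx hxint
    refine (iInf₂_le _ hx).trans_eq ?_
    exact expect_coe_real hxint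
  · exact Integrable.integral_compProd (κ := Kernel.const Unit (α : Measure E))
      (η := Kernel.prodMkLeft Unit κ) (a := ()) hInt

end Necessity

/-! ### Hahn–Banach separation in the weighted class -/

section Separation

/-- A continuous linear functional on a product of lines depends on finitely many coordinates. -/
theorem exists_finset_sum_of_continuousLinearMap {ι : Type*} [DecidableEq ι]
    (φ : (ι → ℝ) →L[ℝ] ℝ) :
    ∃ s : Finset ι, ∀ x, φ x = ∑ i ∈ s, φ (Pi.single i 1) * x i := by
  have hopen : IsOpen (φ ⁻¹' Metric.ball 0 1) := Metric.isOpen_ball.preimage φ.continuous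
  obtain ⟨s, u, hu, hsub⟩ := isOpen_pi_iff.1 hopen 0 (by simp)
  have hzero : ∀ y : ι → ℝ, (∀ i ∈ s, y i = 0) → φ y = 0 := by
    intro y hy
    by_contra hne
    -- Rescaling gives `φ` the value `1` while the coordinates in `s` stay zero, so the point would
    -- lie in a set where `|φ| < 1`.
    have hmem : (φ y)⁻¹ • y ∈ φ ⁻¹' Metric.ball 0 1 := hsub fun i hi => by
      simpa [hy i hi] using (hu i hi).2
    simp [hne] at hmem
  refine ⟨s, fun x => ?_⟩
  have h := hzero (x - ∑ i ∈ s, x i • Pi.single i (1 : ℝ)) fun i hi => by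
    simp [Finset.sum_apply, Pi.single_apply, hi]
  rw [map_sub, sub_eq_zero, map_sum] at h
  rw [h]
  exact Finset.sum_congr rfl fun i _ => by rw [map_smul, smul_eq_mul, mul_comm]

variable {E : Type*} [TopologicalSpace E]

/-- The test functions of the weighted weak topology: the weight and the bounded functions. -/
def testFunction (H : E → ℝ) : Option (BoundedContinuousFunction E ℝ) → E → ℝ
  | none => H
  | some h => h

theorem testFunction_mem {H : E → ℝ} (hH : IsWeight H)
    (o : Option (BoundedContinuousFunction E ℝ)) : testFunction H o ∈ weightedFunctions H := by
  cases o with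
  | none => exact self_mem_weightedFunctions hH
  | some h => exact bounded_mem_weightedFunctions hH h.continuous fun x => h.norm_coe_le_norm x

variable [MeasurableSpace E] [BorelSpace E]

/-- The integrals of all test functions. -/
noncomputable def testIntegrals (H : E → ℝ) (μ : ProbabilityMeasure E) :
    Option (BoundedContinuousFunction E ℝ) → ℝ :=
  fun o => ∫ x, testFunction H o x ∂(μ : Measure E)

/-- A law `β` which cannot be separated from a convex set `M` of laws by a function in the weighted
class is the limit of a sequence in `M`, weakly and with convergence of the moments of the
weight. -/
theorem exists_separating_or_tendsto [PolishSpace E] {H : E → ℝ} (hH : IsWeight H)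
    {M : Set (ProbabilityMeasure E)} (hM : M ⊆ weightedLaws H)
    (hconv : Convex ℝ≥0 ((fun μ : ProbabilityMeasure E => (μ : Measure E)) '' M))
    {β : ProbabilityMeasure E} (hβ : β ∈ weightedLaws H) :
    (∃ f ∈ weightedFunctions H, ∃ u, ∫ x, f x ∂(β : Measure E) < u ∧
      ∀ μ ∈ M, u ≤ ∫ x, f x ∂(μ : Measure E)) ∨
    ∃ μn : ℕ → ProbabilityMeasure E, (∀ n, μn n ∈ M) ∧ Tendsto μn atTop (𝓝 β) ∧
      Tendsto (fun n => ∫ x, H x ∂(μn n : Measure E)) atTop (𝓝 (∫ x, H x ∂(β : Measure E))) := by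
  classical
  have hInt : ∀ μ ∈ weightedLaws H, ∀ o, Integrable (testFunction H o) (μ : Measure E) :=
    fun μ hμ o => integrable_of_mem_weightedFunctions hH (testFunction_mem hH o) hμ
  by_cases hcl : testIntegrals H β ∈ closure (testIntegrals H '' M)
  · right
    let l : Filter (ProbabilityMeasure E) :=
      𝓟 M ⊓ comap (testIntegrals H) (𝓝 (testIntegrals H β))
    have hl : l.NeBot := by
      have h := mem_closure_iff_nhdsWithin_neBot.1 hcl
      rw [nhdsWithin, inf_comm, ← map_principal, ← Filter.push_pull] at h
      exact h.of_map
    have hlim : ∀ o, Tendsto (fun μ : ProbabilityMeasure E => testIntegrals H μ o) l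
        (𝓝 (testIntegrals H β o)) :=
      tendsto_pi_nhds.1 (tendsto_comap.mono_left inf_le_right)
    -- The product over all test functions is too large for sequences; a law together with its
    -- `H`-moment lives in a metrizable space, where closure points are sequential limits.
    have hpair : Tendsto (fun μ : ProbabilityMeasure E => (μ, ∫ x, H x ∂(μ : Measure E))) l
        (𝓝 (β, ∫ x, H x ∂(β : Measure E))) := by
      refine Tendsto.prodMk_nhds ?_ (hlim none)
      exact ProbabilityMeasure.tendsto_iff_forall_integral_tendsto.2 fun h => hlim (some h)
    have hmem : (β, ∫ x, H x ∂(β : Measure E)) ∈ closure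
        ((fun μ : ProbabilityMeasure E => (μ, ∫ x, H x ∂(μ : Measure E))) '' M) :=
      mem_closure_of_tendsto hpair <| by
        filter_upwards [mem_inf_of_left (mem_principal_self M)] with μ hμ
        exact ⟨μ, hμ, rfl⟩
    obtain ⟨z, hz, hzlim⟩ := mem_closure_iff_seq_limit.1 hmem
    choose μn hμn hμz using hz
    have hz' : z = fun n => (μn n, ∫ x, H x ∂(μn n : Measure E)) := funext fun n => (hμz n).symm
    rw [hz'] at hzlim
    exact ⟨μn, hμn, (continuous_fst.tendsto _).comp hzlim, (continuous_snd.tendsto _).comp hzlim⟩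
  · left
    have hconv' : Convex ℝ (testIntegrals H '' M) := by
      rintro _ ⟨μ, hμ, rfl⟩ _ ⟨ν, hν, rfl⟩ a b ha hb hab
      lift a to ℝ≥0 using ha
      lift b to ℝ≥0 using hb
      obtain ⟨ρ, hρ, hρeq⟩ := hconv ⟨μ, hμ, rfl⟩ ⟨ν, hν, rfl⟩ a.2 b.2
        (by exact_mod_cast hab)
      refine ⟨ρ, hρ, funext fun o => ?_⟩
      simp only at hρeq
      simp only [testIntegrals, hρeq, Pi.add_apply, Pi.smul_apply]
      rw [integral_add_measure ((hInt μ (hM hμ) o).smul_measure_nnreal)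
        ((hInt ν (hM hν) o).smul_measure_nnreal), integral_smul_nnreal_measure,
        integral_smul_nnreal_measure]
      rfl
    obtain ⟨φ, u, hφM, hφβ⟩ :=
      geometric_hahn_banach_closed_point hconv'.closure isClosed_closure hcl
    obtain ⟨s, hs⟩ := exists_finset_sum_of_continuousLinearMap φ
    -- The functional sees finitely many test functions, so it is integration of a weighted
    -- function. The sign turns `φ < u` on `M` into a lower bound.
    let f : E → ℝ := fun x => ∑ o ∈ s, -φ (Pi.single o 1) * testFunction H o x
    have hf : f ∈ weightedFunctions H := sum_mem_weightedFunctions hH s fun o _ =>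
      mul_mem_weightedFunctions hH _ (testFunction_mem hH o)
    have hfint : ∀ μ ∈ weightedLaws H, ∫ x, f x ∂(μ : Measure E) = -φ (testIntegrals H μ) := by
      intro μ hμ
      rw [hs, integral_finsetSum _ fun o _ => (hInt μ hμ o).const_mul _, ← Finset.sum_neg_distrib]
      refine Finset.sum_congr rfl fun o _ => ?_
      rw [integral_const_mul, neg_mul]
      rfl
    refine ⟨f, hf, -u, ?_, fun μ hμ => ?_⟩
    · rw [hfint β hβ]; linarith
    · rw [hfint μ (hM hμ)]
      have := hφM _ (subset_closure ⟨μ, hμ, rfl⟩)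
      linarith

/-- A separating function may be chosen to dominate a multiple of the weight. -/
theorem exists_separating_dominating {H : E → ℝ} (hH : IsWeight H)
    {M : Set (ProbabilityMeasure E)} (hM : M ⊆ weightedLaws H)
    {β : ProbabilityMeasure E} (hβ : β ∈ weightedLaws H) {f : E → ℝ} (hf : f ∈ weightedFunctions H)
    {u : ℝ} (hfβ : ∫ x, f x ∂(β : Measure E) < u) (hfM : ∀ μ ∈ M, u ≤ ∫ x, f x ∂(μ : Measure E)) :
    ∃ g ∈ weightedFunctions H, ∃ v, ∃ ε > 0, (∀ x, ε * H x ≤ g x) ∧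
      ∫ x, g x ∂(β : Measure E) < v ∧ ∀ μ ∈ M, v ≤ ∫ x, g x ∂(μ : Measure E) := by
  obtain ⟨c, hc, hcH⟩ := hH.2
  have hfint : ∀ μ ∈ weightedLaws H, Integrable f (μ : Measure E) := fun μ hμ =>
    integrable_of_mem_weightedFunctions hH hf hμ
  -- Truncation from below costs little under `β` and only raises integrals over `M`. Adding `n`
  -- then makes the function nonnegative, leaving room for a small multiple of `H`.
  have hlim : Tendsto (fun n : ℕ => ∫ x, max (f x) (-n) ∂(β : Measure E)) atTop
      (𝓝 (∫ x, f x ∂(β : Measure E))) := by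
    refine tendsto_integral_of_dominated_convergence (fun x => |f x|) (fun n => ?_)
      (hfint β hβ).abs (fun n => Eventually.of_forall fun x => ?_)
      (Eventually.of_forall fun x => ?_)
    · exact (hf.1.max continuous_const).measurable.aestronglyMeasurable
    · have hn : (0 : ℝ) ≤ n := n.cast_nonneg
      rw [Real.norm_eq_abs, abs_le]
      exact ⟨(neg_abs_le _).trans (le_max_left _ _),
        max_le (le_abs_self _) ((neg_nonpos.2 hn).trans (abs_nonneg _))⟩
    · refine tendsto_const_nhds.congr' ?_
      obtain ⟨n, hn⟩ := exists_nat_ge (-f x)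
      filter_upwards [eventually_ge_atTop n] with m hm
      have : (n : ℝ) ≤ m := by exact_mod_cast hm
      exact (max_eq_left (by linarith)).symm
  obtain ⟨n, hn⟩ := (hlim.eventually (gt_mem_nhds hfβ)).exists
  have hI : 0 ≤ ∫ x, H x ∂(β : Measure E) := integral_nonneg fun x => (hc.trans_le (hcH x)).le
  obtain ⟨ε, hε, hεu⟩ : ∃ ε > 0, ∫ x, max (f x) (-n) ∂(β : Measure E) +
      ε * ∫ x, H x ∂(β : Measure E) < u := by
    -- The `+ 1` in the denominator keeps it positive and the final inequality strict.
    refine ⟨(u - ∫ x, max (f x) (-n) ∂(β : Measure E)) /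
      (∫ x, H x ∂(β : Measure E) + 1), by apply div_pos <;> linarith, ?_⟩
    have h1 : 0 < ∫ x, H x ∂(β : Measure E) + 1 := by linarith
    have h2 : (u - ∫ x, max (f x) (-n) ∂(β : Measure E)) / (∫ x, H x ∂(β : Measure E) + 1) *
        ∫ x, H x ∂(β : Measure E) < u - ∫ x, max (f x) (-n) ∂(β : Measure E) := by
      rw [div_mul_eq_mul_div, div_lt_iff₀ h1]
      nlinarith
    linarith
  have hmax : (fun x => max (f x) (-n)) ∈ weightedFunctions H := by
    obtain ⟨hfc, C, hC⟩ := (mem_weightedFunctions_iff hH).1 hf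
    refine (mem_weightedFunctions_iff hH).2 ⟨hfc.max continuous_const, C, fun x => ?_⟩
    refine le_trans ?_ (hC x)
    rw [abs_le]
    exact ⟨(neg_abs_le _).trans (le_max_left _ _),
      max_le (le_abs_self _) ((neg_nonpos.2 n.cast_nonneg).trans (abs_nonneg _))⟩
  have hg : ∀ μ ∈ weightedLaws H, ∫ x, (max (f x) (-n) + n + ε * H x) ∂(μ : Measure E) =
      ∫ x, max (f x) (-n) ∂(μ : Measure E) + n + ε * ∫ x, H x ∂(μ : Measure E) := by
    intro μ hμ
    have h1 := integrable_of_mem_weightedFunctions hH hmax hμ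
    have h2 : Integrable H (μ : Measure E) := hμ
    have h3 : Integrable (fun x => max (f x) (-n) + (n : ℝ)) (μ : Measure E) :=
      h1.add (integrable_const _)
    rw [integral_add h3 (h2.const_mul ε), integral_add h1 (integrable_const _),
      integral_const_mul]
    simp
  refine ⟨fun x => max (f x) (-n) + n + ε * H x, ?_, u + n, ε, hε, fun x => ?_, ?_, fun μ hμ => ?_⟩
  · exact add_mem_weightedFunctions hH (add_mem_weightedFunctions hH hmax
      (bounded_mem_weightedFunctions hH continuous_const (C := |(n : ℝ)|) fun _ => le_rfl))
      (mul_mem_weightedFunctions hH ε (self_mem_weightedFunctions hH))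
  · have := le_max_right (f x) (-n)
    linarith
  · rw [hg β hβ]; linarith
  · rw [hg μ (hM hμ)]
    have h1 : u ≤ ∫ x, max (f x) (-n) ∂(μ : Measure E) := (hfM μ hμ).trans
      (integral_mono (hfint μ (hM hμ)) (integrable_of_mem_weightedFunctions hH hmax (hM hμ))
        fun x => le_max_left _ _)
    have h2 : 0 ≤ ∫ x, H x ∂(μ : Measure E) := integral_nonneg fun x => (hc.trans_le (hcH x)).le
    have := mul_nonneg hε.le h2
    linarith

end Separation

/-! ### Weak limits with moments, and tightness of couplings -/

section WeightedLimits

variable {E : Type*} [TopologicalSpace E] [MeasurableSpace E] [BorelSpace E]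

/-- This is lower semicontinuity from the portmanteau theorem, which needs no upper bound on `f`. -/
theorem eventually_lt_integral_of_tendsto [HasOuterApproxClosed E] {μn : ℕ → ProbabilityMeasure E}
    {μ : ProbabilityMeasure E} (hlim : Tendsto μn atTop (𝓝 μ)) {f : E → ℝ} (hf : Continuous f)
    (hf0 : 0 ≤ f) (hfn : ∀ n, Integrable f (μn n : Measure E)) (hfμ : Integrable f (μ : Measure E))
    {a : ℝ} (ha : a < ∫ x, f x ∂(μ : Measure E)) :
    ∀ᶠ n in atTop, a < ∫ x, f x ∂(μn n : Measure E) := by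
  rcases lt_or_ge a 0 with h0 | h0
  · exact Eventually.of_forall fun n => h0.trans_le (integral_nonneg hf0)
  have h := lintegral_le_liminf_lintegral_of_forall_isOpen_measure_le_liminf_measure
    (μ := (μ : Measure E)) (μs := fun n => (μn n : Measure E)) hf hf0
    fun G hG => ProbabilityMeasure.le_liminf_measure_open_of_tendsto hlim hG
  simp only [← ofReal_integral_eq_lintegral_ofReal hfμ (Eventually.of_forall hf0),
    fun n => (ofReal_integral_eq_lintegral_ofReal (hfn n) (Eventually.of_forall hf0)).symm] at h
  have hlt : ENNReal.ofReal a < ENNReal.ofReal (∫ x, f x ∂(μ : Measure E)) :=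
    (ENNReal.ofReal_lt_ofReal_iff_of_nonneg h0).2 ha
  filter_upwards [eventually_lt_of_lt_liminf (hlt.trans_le h)] with n hn
  exact (ENNReal.ofReal_lt_ofReal_iff_of_nonneg h0).1 hn

/-- Weak convergence together with convergence of the moment of a weight implies convergence of
the integrals of all functions in the weighted class. -/
theorem tendsto_integral_of_mem_weightedFunctions [HasOuterApproxClosed E] {J : E → ℝ}
    (hJ : IsWeight J) {μn : ℕ → ProbabilityMeasure E} {μ : ProbabilityMeasure E}
    (hlim : Tendsto μn atTop (𝓝 μ)) (hJn : ∀ n, μn n ∈ weightedLaws J) (hJμ : μ ∈ weightedLaws J)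
    (hJlim : Tendsto (fun n => ∫ x, J x ∂(μn n : Measure E)) atTop
      (𝓝 (∫ x, J x ∂(μ : Measure E)))) {l : E → ℝ} (hl : l ∈ weightedFunctions J) :
    Tendsto (fun n => ∫ x, l x ∂(μn n : Measure E)) atTop (𝓝 (∫ x, l x ∂(μ : Measure E))) := by
  obtain ⟨-, C, hC⟩ := (mem_weightedFunctions_iff hJ).1 hl
  -- `C * J + k` is nonnegative, hence lower semicontinuous under the limit; subtracting the
  -- convergent `J`-moment leaves the bound for `k`. Using it for `l` and `-l` gives convergence.
  have lower : ∀ k ∈ weightedFunctions J, (∀ x, |k x| ≤ C * J x) →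
      ∀ a < ∫ x, k x ∂(μ : Measure E), ∀ᶠ n in atTop, a < ∫ x, k x ∂(μn n : Measure E) := by
    intro k hk hkC a ha
    have hkint : ∀ ν ∈ weightedLaws J, Integrable k (ν : Measure E) := fun ν hν =>
      integrable_of_mem_weightedFunctions hJ hk hν
    have hsum : ∀ ν ∈ weightedLaws J, ∫ x, (C * J x + k x) ∂(ν : Measure E) =
        C * ∫ x, J x ∂(ν : Measure E) + ∫ x, k x ∂(ν : Measure E) := fun ν hν => by
      rw [integral_add (Integrable.const_mul hν C) (hkint ν hν), integral_const_mul]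
    obtain ⟨b, hab, hb⟩ := exists_between ha
    have h1 := eventually_lt_integral_of_tendsto hlim (f := fun x => C * J x + k x)
      ((hJ.1.const_mul C).add hk.1) (fun x => by have := neg_le_of_abs_le (hkC x); simp; linarith)
      (fun n => (Integrable.const_mul (hJn n) C).add (hkint _ (hJn n)))
      ((Integrable.const_mul hJμ C).add (hkint _ hJμ))
      (a := C * ∫ x, J x ∂(μ : Measure E) + b) (by rw [hsum μ hJμ]; linarith)
    have h2 := (hJlim.const_mul C).eventually
      (gt_mem_nhds (show _ < C * ∫ x, J x ∂(μ : Measure E) + (b - a) by linarith))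
    filter_upwards [h1, h2] with n hn1 hn2
    rw [hsum _ (hJn n)] at hn1
    linarith
  refine tendsto_order.2 ⟨lower l hl hC, fun a ha => ?_⟩
  have hneg : (fun x => -l x) ∈ weightedFunctions J := by
    simpa using mul_mem_weightedFunctions hJ (-1) hl
  filter_upwards [lower _ hneg (by simpa using hC) (-a) (by rw [integral_neg]; linarith)] with n hn
  rw [integral_neg] at hn
  linarith

variable [PolishSpace E]

/-- Laws on a product with a fixed first marginal and convergent second marginals have a convergent
subsequence. -/
theorem exists_subseq_tendsto_of_marginals {α β : ProbabilityMeasure E}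
    {μn : ℕ → ProbabilityMeasure E} (hlim : Tendsto μn atTop (𝓝 β))
    {R : ℕ → ProbabilityMeasure (E × E)} (hfst : ∀ n, (R n : Measure (E × E)).map Prod.fst = α)
    (hsnd : ∀ n, (R n : Measure (E × E)).map Prod.snd = μn n) :
    ∃ (R' : ProbabilityMeasure (E × E)) (φ : ℕ → ℕ), StrictMono φ ∧
      Tendsto (R ∘ φ) atTop (𝓝 R') ∧ (R' : Measure (E × E)).map Prod.fst = α ∧
      (R' : Measure (E × E)).map Prod.snd = β := by
  let := TopologicalSpace.upgradeIsCompletelyMetrizable E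
  have hα := isTightMeasureSet_iff_exists_isCompact_measure_compl_le.1
    (isTightMeasureSet_singleton (μ := (α : Measure E)))
  have hβ := isTightMeasureSet_iff_exists_isCompact_measure_compl_le.1
    -- A convergent sequence with its limit is compact, so its members are uniformly tight.
    (isTightMeasureSet_of_isCompact_closure (S := Set.range μn)
      (hlim.isCompact_insert_range.closure_of_subset (Set.subset_insert _ _)))
  have htight : IsTightMeasureSet
      {((μ : ProbabilityMeasure (E × E)) : Measure (E × E)) | μ ∈ Set.range R} := by
    refine isTightMeasureSet_iff_exists_isCompact_measure_compl_le.2 fun ε hε => ?_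
    obtain ⟨K, hK, hKα⟩ := hα (ε / 2) (ENNReal.half_pos hε.ne')
    obtain ⟨L, hL, hLβ⟩ := hβ (ε / 2) (ENNReal.half_pos hε.ne')
    refine ⟨K ×ˢ L, hK.prod hL, ?_⟩
    rintro _ ⟨_, ⟨n, rfl⟩, rfl⟩
    have hsub : (K ×ˢ L)ᶜ ⊆ Prod.fst ⁻¹' Kᶜ ∪ (Prod.snd ⁻¹' Lᶜ : Set (E × E)) := by
      intro z hz
      by_contra h
      simp only [Set.mem_union, Set.mem_preimage, Set.mem_compl_iff, not_or, not_not] at h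
      exact hz h
    calc (R n : Measure (E × E)) (K ×ˢ L)ᶜ
        ≤ (R n : Measure (E × E)) (Prod.fst ⁻¹' Kᶜ) + (R n : Measure (E × E)) (Prod.snd ⁻¹' Lᶜ) :=
          (measure_mono hsub).trans (measure_union_le _ _)
      _ = (α : Measure E) Kᶜ + (μn n : Measure E) Lᶜ := by
          rw [← hfst n, ← hsnd n, Measure.map_apply measurable_fst hK.measurableSet.compl,
            Measure.map_apply measurable_snd hL.measurableSet.compl]
      _ ≤ ε / 2 + ε / 2 := add_le_add (hKα _ rfl) (hLβ _ ⟨_, ⟨n, rfl⟩, rfl⟩)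
      _ = ε := ENNReal.add_halves ε
  obtain ⟨R', -, φ, hφ, hR'⟩ := (isCompact_closure_of_isTightMeasureSet htight).tendsto_subseq
    (x := R) fun n => subset_closure ⟨n, rfl⟩
  refine ⟨R', φ, hφ, hR', ?_, ?_⟩
  · have h := ProbabilityMeasure.tendsto_map_of_tendsto_of_continuous _ _ hR' continuous_fst
    have hc : ∀ n, ((R ∘ φ) n).map continuous_fst.measurable.aemeasurable = α := fun n =>
      Subtype.ext (hfst (φ n))
    simp only [hc] at h
    have heq := tendsto_nhds_unique h tendsto_const_nhds
    exact congrArg (fun μ : ProbabilityMeasure E => (μ : Measure E)) heq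
  · have h := ProbabilityMeasure.tendsto_map_of_tendsto_of_continuous _ _ hR' continuous_snd
    have hc : ∀ n, ((R ∘ φ) n).map continuous_snd.measurable.aemeasurable = μn (φ n) := fun n =>
      Subtype.ext (hsnd (φ n))
    simp only [hc] at h
    have heq := tendsto_nhds_unique h (hlim.comp hφ.tendsto_atTop)
    exact congrArg (fun μ : ProbabilityMeasure E => (μ : Measure E)) heq

end WeightedLimits

/-! ### The duality on a general path space -/

section Duality

theorem isWeight_directSum {E : Type*} [TopologicalSpace E] {G H : E → ℝ} (hG : IsWeight G)
    (hH : IsWeight H) : IsWeight (directSum G H) := by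
  obtain ⟨a, ha, haG⟩ := hG.2
  obtain ⟨b, hb, hbH⟩ := hH.2
  exact ⟨(hG.1.comp continuous_fst).add (hH.1.comp continuous_snd), a + b, add_pos ha hb,
    fun z => add_le_add (haG _) (hbH _)⟩

variable {Ω E : Type*} [MeasurableSpace Ω] [MeasurableSpace E]

/-- The terminal laws with finite weight among a set of laws on `Ω`. -/
def terminalLaws (XT : Ω → E) (H : E → ℝ) (S : Set (ProbabilityMeasure Ω)) :
    Set (ProbabilityMeasure E) :=
  {μ | μ ∈ weightedLaws H ∧ ∃ P ∈ S, (P : Measure Ω).map XT = μ}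

/-- Convexity is assumed of joint endpoint laws only: the mixture of the joint laws is realised by a
third law in `S`, whose terminal law is the required mixture. -/
theorem convex_terminalLaws {X₀ XT : Ω → E} (hX₀ : Measurable X₀) (hXT : Measurable XT)
    {H : E → ℝ} {S : Set (ProbabilityMeasure Ω)} (hS : IsConvexLaws (jointLaws X₀ XT S)) :
    Convex ℝ≥0 ((fun μ : ProbabilityMeasure E => (μ : Measure E)) '' terminalLaws XT H S) := by
  have hpair : Measurable fun ω => (X₀ ω, XT ω) := hX₀.prodMk hXT
  have key : ∀ P ∈ S, (P : Measure Ω).map (fun ω => (X₀ ω, XT ω)) ∈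
      (fun R : ProbabilityMeasure (E × E) => (R : Measure (E × E))) '' jointLaws X₀ XT S :=
    fun P hP => ⟨P.map hpair.aemeasurable, ⟨P, hP, rfl⟩, rfl⟩
  have hsnd : ∀ P : ProbabilityMeasure Ω,
      ((P : Measure Ω).map (fun ω => (X₀ ω, XT ω))).map Prod.snd = (P : Measure Ω).map XT :=
    fun P => Measure.map_map measurable_snd hpair
  rintro _ ⟨μ, ⟨hμH, P, hP, hPμ⟩, rfl⟩ _ ⟨ν, ⟨hνH, Q, hQ, hQν⟩, rfl⟩ a b ha hb hab
  obtain ⟨R, ⟨P', hP', hRP'⟩, hR⟩ := hS (key P hP) (key Q hQ) ha hb hab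
  have hmap : (P' : Measure Ω).map XT = a • (μ : Measure E) + b • (ν : Measure E) := by
    rw [← hsnd, ← hRP', ← hPμ, ← hQν, ← hsnd, ← hsnd]
    simp only at hR
    rw [hR, Measure.map_add _ _ measurable_snd, Measure.map_smul, Measure.map_smul]
  refine ⟨P'.map hXT.aemeasurable, ⟨?_, P', hP', rfl⟩, hmap⟩
  change Integrable H ((P' : Measure Ω).map XT)
  rw [hmap]
  exact (Integrable.smul_measure_nnreal hμH).add_measure (Integrable.smul_measure_nnreal hνH)

/-- For a nonnegative function, the lower envelope may be computed in `ℝ≥0∞`. -/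
theorem lintegral_le_expect_lowerEnvelope (XT : Ω → E)
    (Γ : E → Set (ProbabilityMeasure Ω)) (α : Measure E) {f : E → ℝ} (hf0 : ∀ x, 0 ≤ f x) :
    ((∫⁻ x, ⨅ Q ∈ Γ x, ∫⁻ ω, ENNReal.ofReal (f (XT ω)) ∂(Q : Measure Ω) ∂α : ℝ≥0∞) : EReal) ≤
      expect α (lowerEnvelope XT Γ f) := by
  rw [← expect_coe_ennreal]
  refine expect_mono (Eventually.of_forall fun x => ?_)
  refine le_iInf₂ fun Q hQ => ?_
  have h : (fun ω => (f (XT ω) : EReal)) =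
      fun ω => ((ENNReal.ofReal (f (XT ω)) : ℝ≥0∞) : EReal) := by
    funext ω
    rw [EReal.coe_ennreal_ofReal, max_eq_left (hf0 _)]
  rw [h, expect_coe_ennreal]
  exact EReal.coe_ennreal_le_coe_ennreal_iff.2 (iInf₂_le Q hQ)

variable [TopologicalSpace Ω] [BorelSpace Ω] [HasOuterApproxClosed Ω]
  [TopologicalSpace E] [PolishSpace E] [BorelSpace E]

/-- The duality theorem on a path space with measurable initial and terminal values. -/
theorem nonempty_iff_expect_lowerEnvelope_le {X₀ XT : Ω → E} (hX₀ : Measurable X₀)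
    (hXT : Measurable XT) {G H : E → ℝ} (hG : IsWeight G) (hH : IsWeight H)
    {Γ : E → Set (ProbabilityMeasure Ω)} (hΓ : IsConstraint X₀ Γ)
    {α β : ProbabilityMeasure E} (hα : α ∈ weightedLaws G) (hβ : β ∈ weightedLaws H)
    (hconv : IsConvexLaws
      (jointLaws X₀ XT (lawsWithMarginal X₀ α ∩ constrainedLaws X₀ Γ)))
    (hclosed : IsWeightClosed (directSum G H)
      (jointLaws X₀ XT (lawsWithMarginal X₀ α ∩ constrainedLaws X₀ Γ))) :
    (lawsWithMarginal X₀ α ∩ lawsWithMarginal XT β ∩ constrainedLaws X₀ Γ).Nonempty ↔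
      ∀ f ∈ weightedFunctions H, expect (α : Measure E) (lowerEnvelope XT Γ f)
        ≤ ((∫ x, f x ∂(β : Measure E) : ℝ) : EReal) := by
  constructor
  · rintro ⟨P, ⟨hA, hB⟩, hC⟩ f hf
    exact expect_lowerEnvelope_le hX₀ hXT hA hB hC
      (integrable_of_mem_weightedFunctions hH hf hβ)
  intro hle
  set S := lawsWithMarginal X₀ α ∩ constrainedLaws X₀ Γ with hS
  have hpair : Measurable fun ω => (X₀ ω, XT ω) := hX₀.prodMk hXT
  have hMH : terminalLaws XT H S ⊆ weightedLaws H := fun μ hμ => hμ.1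
  rcases exists_separating_or_tendsto hH hMH (convex_terminalLaws hX₀ hXT hconv) hβ with
    ⟨f, hf, u, hfβ, hfM⟩ | ⟨μn, hμn, hlim, hlimH⟩
  · exfalso
    obtain ⟨g, hg, v, ε, hε, hεg, hgβ, hgM⟩ := exists_separating_dominating hH hMH hβ hf hfβ hfM
    obtain ⟨c, hc, hcH⟩ := hH.2
    have hg0 : ∀ x, 0 ≤ g x := fun x =>
      (mul_nonneg hε.le (hc.trans_le (hcH x)).le).trans (hεg x)
    have hgβ0 : 0 ≤ ∫ x, g x ∂(β : Measure E) := integral_nonneg hg0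
    have h1 := (lintegral_le_expect_lowerEnvelope XT Γ (α : Measure E) hg0).trans (hle g hg)
    have h2 : ∫⁻ x, ⨅ Q ∈ Γ x, ∫⁻ ω, ENNReal.ofReal (g (XT ω)) ∂(Q : Measure Ω) ∂(α : Measure E)
        < ENNReal.ofReal v := by
      refine lt_of_le_of_lt ?_ ((ENNReal.ofReal_lt_ofReal_iff_of_nonneg hgβ0).2 hgβ)
      rw [← EReal.coe_ennreal_le_coe_ennreal_iff, EReal.coe_ennreal_ofReal, max_eq_left hgβ0]
      exact h1
    have hgm : Measurable fun ω => g (XT ω) := hg.1.measurable.comp hXT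
    obtain ⟨P, hP, hPlt⟩ := exists_law_lintegral_lt hX₀ hΓ α hgm.ennreal_ofReal h2
    have hgint : Integrable (fun ω => g (XT ω)) (P : Measure Ω) :=
      (lintegral_ofReal_ne_top_iff_integrable hgm.aestronglyMeasurable
        (Eventually.of_forall fun ω => hg0 _)).1 hPlt.ne_top
    -- Here `ε H ≤ g` is used: a finite `g`-integral forces a finite `H`-moment, so the separating
    -- bound applies to the terminal law of `P`.
    have hHint : Integrable H ((P : Measure Ω).map XT) := by
      rw [integrable_map_measure hH.1.measurable.aestronglyMeasurable hXT.aemeasurable]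
      refine (hgint.const_mul ε⁻¹).mono' (hH.1.measurable.comp hXT).aestronglyMeasurable
        (Eventually.of_forall fun ω => ?_)
      rw [Function.comp_apply, Real.norm_eq_abs, abs_of_pos (hc.trans_le (hcH _)),
        inv_mul_eq_div, le_div_iff₀ hε, mul_comm]
      exact hεg _
    have hv := hgM (P.map hXT.aemeasurable) ⟨hHint, P, hP, rfl⟩
    change v ≤ ∫ x, g x ∂((P : Measure Ω).map XT) at hv
    rw [integral_map hXT.aemeasurable hg.1.measurable.aestronglyMeasurable] at hv
    rw [← ofReal_integral_eq_lintegral_ofReal hgint (Eventually.of_forall fun ω => hg0 _)] at hPlt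
    exact absurd hPlt (not_lt.2 (ENNReal.ofReal_le_ofReal hv))
  · choose hμH P hPS hPμ using hμn
    let R : ℕ → ProbabilityMeasure (E × E) := fun n => (P n).map hpair.aemeasurable
    have hfst : ∀ n, (R n : Measure (E × E)).map Prod.fst = α := fun n =>
      (Measure.map_map measurable_fst hpair).trans (hPS n).1
    have hsnd : ∀ n, (R n : Measure (E × E)).map Prod.snd = μn n := fun n =>
      (Measure.map_map measurable_snd hpair).trans (hPμ n)
    -- The `J`-moment depends on the marginals alone. Its `G`-part is fixed by `α`, so convergence
    -- of `H`-moments gives that of `J`-moments.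
    have hJ : ∀ {Q : ProbabilityMeasure (E × E)} {μ : ProbabilityMeasure E},
        (Q : Measure (E × E)).map Prod.fst = α → (Q : Measure (E × E)).map Prod.snd = μ →
        μ ∈ weightedLaws H → Q ∈ weightedLaws (directSum G H) ∧
          ∫ z, directSum G H z ∂(Q : Measure (E × E)) =
            ∫ x, G x ∂(α : Measure E) + ∫ x, H x ∂(μ : Measure E) := by
      intro Q μ hQ1 hQ2 hμ
      have hG' : Integrable (fun z : E × E => G z.1) (Q : Measure (E × E)) := by
        have : Integrable G ((Q : Measure (E × E)).map Prod.fst) := hQ1 ▸ hα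
        exact this.comp_measurable measurable_fst
      have hH' : Integrable (fun z : E × E => H z.2) (Q : Measure (E × E)) := by
        have : Integrable H ((Q : Measure (E × E)).map Prod.snd) := hQ2 ▸ hμ
        exact this.comp_measurable measurable_snd
      refine ⟨hG'.add hH', ?_⟩
      rw [← hQ1, ← hQ2, integral_map measurable_fst.aemeasurable
        hG.1.measurable.aestronglyMeasurable, integral_map measurable_snd.aemeasurable
        hH.1.measurable.aestronglyMeasurable, ← integral_add hG' hH']
      rfl
    obtain ⟨R', φ, hφ, hR', hR'1, hR'2⟩ := exists_subseq_tendsto_of_marginals hlim hfst hsnd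
    have hmem : R' ∈ jointLaws X₀ XT S := by
      refine hclosed (R ∘ φ) R' (fun n => ⟨P (φ n), hPS _, rfl⟩)
        (fun n => (hJ (hfst _) (hsnd _) (hμH (φ n))).1) (hJ hR'1 hR'2 hβ).1 fun l hl => ?_
      refine tendsto_integral_of_mem_weightedFunctions (isWeight_directSum hG hH) hR'
        (fun n => (hJ (hfst _) (hsnd _) (hμH (φ n))).1) (hJ hR'1 hR'2 hβ).1 ?_ hl
      rw [(hJ hR'1 hR'2 hβ).2]
      simp only [Function.comp_apply, fun n => (hJ (hfst _) (hsnd _) (hμH (φ n))).2]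
      exact (hlimH.comp hφ.tendsto_atTop).const_add _
    obtain ⟨P', hP', hRP⟩ := hmem
    refine ⟨P', ⟨hP'.1, ?_⟩, hP'.2⟩
    change (P' : Measure Ω).map XT = β
    rw [← hR'2, hRP, Measure.map_map measurable_snd hpair]
    rfl

end Duality

/-! ### Endpoint evaluations on the Skorokhod space -/

namespace SkorokhodPath

variable {E : Type*} [PseudoEMetricSpace E]

/-- At a time fixed by all time changes, the cost of each is at least the distance of the two values
there. The endpoints of `I` are such times. -/
theorem lipschitzWith_eval_of_fixed {t : I} (ht : ∀ lam : I ≃o I, lam t = t) :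
    LipschitzWith 1 fun ω : SkorokhodPath E => ω t := by
  intro f g
  rw [ENNReal.coe_one, one_mul]
  refine le_iInf fun lam => ?_
  refine le_trans ?_ (le_max_right _ _)
  exact le_iSup_of_le t (by rw [ht lam])

theorem continuous_eval_zero : Continuous fun ω : SkorokhodPath E => ω 0 :=
  (lipschitzWith_eval_of_fixed fun lam => map_bot lam).continuous

theorem continuous_eval_one : Continuous fun ω : SkorokhodPath E => ω 1 :=
  (lipschitzWith_eval_of_fixed fun lam => map_top lam).continuous

end SkorokhodPath

end ConstrainedTransport

/-! ### The three path spaces -/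

theorem theorem1 :
    -- paths in discrete time
    (∀ (E : Type*) [TopologicalSpace E] [PolishSpace E] [MeasurableSpace E] [BorelSpace E] (N : ℕ)
        (G H : E → ℝ) (_ : IsWeight G) (_ : IsWeight H)
        (Γ : E → Set (ProbabilityMeasure (Fin (N + 1) → E)))
        (_ : IsConstraint (fun ω : Fin (N + 1) → E => ω 0) Γ)
        (α β : ProbabilityMeasure E) (_ : α ∈ weightedLaws G) (_ : β ∈ weightedLaws H)
        (A B C : Set (ProbabilityMeasure (Fin (N + 1) → E)))
        (_ : A = lawsWithMarginal (fun ω => ω 0) α)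
        (_ : B = lawsWithMarginal (fun ω => ω (Fin.last N)) β)
        (_ : C = constrainedLaws (fun ω => ω 0) Γ)
        (_ : IsConvexLaws (jointLaws (fun ω => ω 0) (fun ω => ω (Fin.last N)) (A ∩ C)))
        (_ : IsWeightClosed (directSum G H)
          (jointLaws (fun ω => ω 0) (fun ω => ω (Fin.last N)) (A ∩ C))),
        (A ∩ B ∩ C).Nonempty ↔
          ∀ f ∈ weightedFunctions H,
            expect (α : Measure E) (lowerEnvelope (fun ω => ω (Fin.last N)) Γ f)
              ≤ ((∫ x, f x ∂(β : Measure E) : ℝ) : EReal)) ∧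
    -- continuous paths
    (∀ (d : ℕ) (V : Set (EuclideanSpace ℝ (Fin d))) (_ : IsClosed V) (_ : IsConnected V)
        (G H : V → ℝ) (_ : IsWeight G) (_ : IsWeight H)
        (Γ : V → Set (ProbabilityMeasure (C(I, V))))
        (_ : IsConstraint (fun ω : C(I, V) => ω 0) Γ)
        (α β : ProbabilityMeasure V) (_ : α ∈ weightedLaws G) (_ : β ∈ weightedLaws H)
        (A B C : Set (ProbabilityMeasure (C(I, V))))
        (_ : A = lawsWithMarginal (fun ω => ω 0) α)
        (_ : B = lawsWithMarginal (fun ω => ω 1) β)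
        (_ : C = constrainedLaws (fun ω => ω 0) Γ)
        (_ : IsConvexLaws (jointLaws (fun ω => ω 0) (fun ω => ω 1) (A ∩ C)))
        (_ : IsWeightClosed (directSum G H)
          (jointLaws (fun ω => ω 0) (fun ω => ω 1) (A ∩ C))),
        (A ∩ B ∩ C).Nonempty ↔
          ∀ f ∈ weightedFunctions H,
            expect (α : Measure V) (lowerEnvelope (fun ω => ω 1) Γ f)
              ≤ ((∫ x, f x ∂(β : Measure V) : ℝ) : EReal)) ∧
    -- right continuous paths with left limits
    (∀ (d : ℕ) (V : Set (EuclideanSpace ℝ (Fin d))) (_ : IsClosed V) (_ : IsConnected V)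
        (G H : V → ℝ) (_ : IsWeight G) (_ : IsWeight H)
        (Γ : V → Set (ProbabilityMeasure (SkorokhodPath V)))
        (_ : IsConstraint (fun ω : SkorokhodPath V => ω 0) Γ)
        (α β : ProbabilityMeasure V) (_ : α ∈ weightedLaws G) (_ : β ∈ weightedLaws H)
        (A B C : Set (ProbabilityMeasure (SkorokhodPath V)))
        (_ : A = lawsWithMarginal (fun ω => ω 0) α)
        (_ : B = lawsWithMarginal (fun ω => ω 1) β)
        (_ : C = constrainedLaws (fun ω => ω 0) Γ)
        (_ : IsConvexLaws (jointLaws (fun ω => ω 0) (fun ω => ω 1) (A ∩ C)))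
        (_ : IsWeightClosed (directSum G H)
          (jointLaws (fun ω => ω 0) (fun ω => ω 1) (A ∩ C))),
        (A ∩ B ∩ C).Nonempty ↔
          ∀ f ∈ weightedFunctions H,
            expect (α : Measure V) (lowerEnvelope (fun ω => ω 1) Γ f)
              ≤ ((∫ x, f x ∂(β : Measure V) : ℝ) : EReal)) := by
  refine ⟨?_, ?_, ?_⟩
  · intro E _ _ _ _ N G H hG hH Γ hΓ α β hα hβ A B C hA hB hC hconv hclosed
    subst hA hB hC
    exact nonempty_iff_expect_lowerEnvelope_le (measurable_pi_apply 0)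
      (measurable_pi_apply (Fin.last N)) hG hH hΓ hα hβ hconv hclosed
  · intro d V hV _ G H hG hH Γ hΓ α β hα hβ A B C hA hB hC hconv hclosed
    subst hA hB hC
    have : PolishSpace V := hV.polishSpace
    exact nonempty_iff_expect_lowerEnvelope_le
      (continuous_eval_const (F := C(I, V)) (0 : I)).measurable
      (continuous_eval_const (F := C(I, V)) (1 : I)).measurable hG hH hΓ hα hβ hconv hclosed
  · intro d V hV _ G H hG hH Γ hΓ α β hα hβ A B C hA hB hC hconv hclosed
    subst hA hB hC
    have : PolishSpace V := hV.polishSpace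
    exact nonempty_iff_expect_lowerEnvelope_le SkorokhodPath.continuous_eval_zero.measurable
      SkorokhodPath.continuous_eval_one.measurable hG hH hΓ hα hβ hconv hclosed
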